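/- Let $\mathsf X\subset\mathbb R^d$ be open, $K\subset\mathsf X$ nonempty, compact and convex, and let $f:\mathsf X\to\mathbb R$ be locally Lipschitz. For $x\in\mathsf X$ and $h\in\mathbb R^d$ let $$f^0(x,h)=\limsup_{y\to x,\ \lambda\downarrow 0}\frac{f(y+\lambda h)-f(y)}{\lambda},\qquad \bar\partial f(x)=\{\zeta\in\mathbb R^d:\ \langle h,\zeta\rangle\le f^0(x,h)\ \text{ for all } h\in\mathbb R^d\}$$ be the generalized directional derivative and the Clarke generalized gradient. Assume that $f$ is regular on $\mathsf X$, i.e. for all $x\in\mathsf X$ and $h\in\mathbb R^d$ the limit $\lim_{\lambda\downarrow0}(f(x+\lambda h)-f(x))/\lambda$ exists and equals $f^0(x,h)$. For $x\in K$ let $N_K(x)=\{g\in\mathbb R^d:\ \langle g,z-x\rangle\le 0\ \text{ for all } z\in K\}$ be the normal cone, let $\Pi_K$ be the Euclidean projection onto $K$, and set $$\mathcal S=\{x\in K:\ 0\in-\bar\partial f(x)-N_K(x)\}.$$ Let $(\gamma_k)_{k\ge1}$ satisfy $\gamma_k>0$, $\sum_{k\ge1}\gamma_k=\infty$ and $\gamma_k\to0$.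 Let $(\delta_k)_{k\ge1}$ be a sequence in $\mathbb R^d$ with $\sup_{k\ge1}\|\delta_k\|<\infty$ that can be written as $\delta_k=e_k+r_k$, where $\|r_k\|\to0$ and the series $\sum_{k\ge1}\gamma_k e_k$ converges. Let $x_0\in\mathsf X$ and, for $k\ge1$, $$x_k=\Pi_K(x_{k-1}-\gamma_kY_k),\qquad Y_k=v_k+\delta_k,\quad v_k\in\bar\partial f(x_{k-1}).$$ **Theorem.** If $f(\mathcal S)$ has empty interior in $\mathbb R$, then $(x_k)$ converges to $\mathcal S$, i.e. $\mathcal S\neq\emptyset$ and $\lim_{k\to\infty}\operatorname{dist}(x_k,\mathcal S)=0$. -/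

import Mathlib

open Filter Topology
open scoped Pointwise

section

variable {E : Type*} [NormedAddCommGroup E] [InnerProductSpace ℝ E]

/-- Clarke's generalized directional derivative
`f⁰(x; h) = limsup_{y → x, t ↓ 0} (f (y + t h) - f y) / t`.
Only the values of `f` near `x` matter; for `f` Lipschitz near `x` the quotients are bounded, so
that the `limsup` in `ℝ` is the genuine one. -/
noncomputable def clarkeDirDeriv (f : E → ℝ) (x h : E) : ℝ :=
  limsup (fun p : E × ℝ => (f (p.1 + p.2 • h) - f p.1) / p.2) (𝓝 x ×ˢ 𝓝[>] (0 : ℝ))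

/-- The Clarke generalized gradient of `f` at `x`. -/
def clarkeGradient (f : E → ℝ) (x : E) : Set E :=
  {ζ | ∀ h : E, inner ℝ h ζ ≤ clarkeDirDeriv f x h}

/-- `f` is (Clarke) regular at `x`: all one-sided directional derivatives exist and coincide with
the generalized ones. -/
def IsClarkeRegularAt (f : E → ℝ) (x : E) : Prop :=
  ∀ h : E, Tendsto (fun t : ℝ => (f (x + t • h) - f x) / t) (𝓝[>] (0 : ℝ))
    (𝓝 (clarkeDirDeriv f x h))

/-- The normal cone to `K` at `x`. -/
def normalConeAt (K : Set E) (x : E) : Set E :=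
  {g | ∀ z ∈ K, inner ℝ g (z - x) ≤ 0}

/-- `p` is a Euclidean projection of `w` onto `K`, i.e. a point of `K` nearest to `w`. For a
nonempty closed convex `K` in a complete space there is exactly one, so this says `p = Π_K(w)`. -/
def IsProjectionOnto (K : Set E) (w p : E) : Prop :=
  p ∈ K ∧ ∀ z ∈ K, ‖w - p‖ ≤ ‖w - z‖

/-- The stationary points of `f` on `K`: those `x ∈ K` with `0 ∈ -∂̄f(x) - N_K(x)`. -/
def stationarySet (f : E → ℝ) (K : Set E) : Set E :=
  {x | x ∈ K ∧ (0 : E) ∈ -clarkeGradient f x - normalConeAt K x}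

end

/-!
Shift time to the `n`-th step and let `n → ∞` along an ultrafilter: the partial sums of the
gradients and of the normals over windows of fixed duration converge to Lipschitz curves, while the
weighted noise cancels out, so the iterates converge to a solution of the differential inclusion
`y' ∈ -∂̄f(y) - N_K(y)`. Regularity of `f` gives a chain rule along `y`, whence `(f ∘ y)' ≤ -‖y'‖²`
almost everywhere. Thus `f ∘ y` decreases, and it decreases strictly when `y` starts outside `𝒮`.

Suppose a limit point `p` of the iterates is not in `𝒮`. The flow from `p` brings `f` below `f p`,
so the iterates have values near `f p` and values near a smaller number infinitely often. As `f(𝒮)`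
has empty interior, some `c ∉ f(𝒮)` lies strictly in between, and `f (x k)` climbs from `c` to some
`d > c` infinitely often. Restarting at the beginnings of these climbs gives in the limit a flow
which starts at the value `c`, hence outside `𝒮`, but does not drop below `c` for a short while,
because a climb by `d - c` takes time bounded below. This contradicts the strict decrease.
-/

section ClarkeCalculus

open scoped NNReal

variable {E : Type*} [NormedAddCommGroup E] [InnerProductSpace ℝ E]
  {f : E → ℝ} {K : Set E} {x ζ η : E} {L : ℝ≥0} {s : Set E}

/-- `f` is Lipschitz on some neighbourhood of `x`. Asking this at every point of `K` is the same as
asking that `f` be locally Lipschitz on some open set containing `K`. -/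
def IsLipschitzNear {α β : Type*} [PseudoEMetricSpace α] [PseudoEMetricSpace β]
    (f : α → β) (x : α) : Prop :=
  ∃ L : ℝ≥0, ∃ s ∈ 𝓝 x, LipschitzOnWith L f s

/-- The difference quotient of `f` at `y` in direction `h` with step `t`, as a function of the pair
`p = (y, t)` along which Clarke's derivative is a `limsup`. -/
noncomputable def clarkeQuotient (f : E → ℝ) (h : E) (p : E × ℝ) : ℝ :=
  (f (p.1 + p.2 • h) - f p.1) / p.2

lemma IsLipschitzNear.continuousAt {α β : Type*} [PseudoEMetricSpace α] [PseudoEMetricSpace β]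
    {f : α → β} {x : α} (hf : IsLipschitzNear f x) : ContinuousAt f x :=
  let ⟨_, _, hs, hL⟩ := hf
  hL.continuousOn.continuousAt hs

lemma isLipschitzNear_of_locallyLipschitzOn {α β : Type*} [PseudoEMetricSpace α]
    [PseudoEMetricSpace β] {f : α → β} {X : Set α} {x : α} (hf : LocallyLipschitzOn X f)
    (hX : X ∈ 𝓝 x) : IsLipschitzNear f x := by
  obtain ⟨L, s, hs, hL⟩ := hf (mem_of_mem_nhds hX)
  exact ⟨L, s, nhdsWithin_eq_nhds.2 hX ▸ hs, hL⟩

lemma locallyLipschitzOn_of_isLipschitzNear {α β : Type*} [PseudoEMetricSpace α]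
    [PseudoEMetricSpace β] {f : α → β} {K : Set α} (hf : ∀ z ∈ K, IsLipschitzNear f z) :
    LocallyLipschitzOn K f := fun z hz =>
  let ⟨L, s, hs, hL⟩ := hf z hz
  ⟨L, s, mem_nhdsWithin_of_mem_nhds hs, hL⟩

lemma eventually_abs_clarkeQuotient_le (hs : s ∈ 𝓝 x) (hL : LipschitzOnWith L f s) (h : E) :
    ∀ᶠ p in 𝓝 x ×ˢ 𝓝[>] (0 : ℝ), |clarkeQuotient f h p| ≤ L * ‖h‖ := by
  have hmove : Tendsto (fun p : E × ℝ => p.1 + p.2 • h) (𝓝 x ×ˢ 𝓝[>] (0 : ℝ)) (𝓝 x) := by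
    have : Tendsto (fun p : E × ℝ => p.1 + p.2 • h) (𝓝 (x, (0 : ℝ))) (𝓝 x) :=
      Continuous.tendsto' (by fun_prop) _ _ (by simp)
    refine this.mono_left ?_
    rw [nhds_prod_eq]
    exact Filter.prod_mono le_rfl nhdsWithin_le_nhds
  filter_upwards [hmove hs, tendsto_fst hs, tendsto_snd self_mem_nhdsWithin]
    with p hmoved hbase (hpos : 0 < p.2)
  have hdist := hL.dist_le_mul _ hmoved _ hbase
  rw [Real.dist_eq, dist_eq_norm, add_sub_cancel_left, norm_smul,
    Real.norm_of_nonneg hpos.le] at hdist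
  rw [clarkeQuotient, abs_div, abs_of_pos hpos, div_le_iff₀ hpos]
  linarith

lemma isBoundedUnder_le_clarkeQuotient (hs : s ∈ 𝓝 x) (hL : LipschitzOnWith L f s) (h : E) :
    IsBoundedUnder (· ≤ ·) (𝓝 x ×ˢ 𝓝[>] (0 : ℝ)) (clarkeQuotient f h) :=
  ⟨L * ‖h‖, eventually_map.2 <|
    (eventually_abs_clarkeQuotient_le hs hL h).mono fun _ hp => (abs_le.1 hp).2⟩

lemma isCoboundedUnder_le_clarkeQuotient (hs : s ∈ 𝓝 x) (hL : LipschitzOnWith L f s) (h : E) :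
    IsCoboundedUnder (· ≤ ·) (𝓝 x ×ˢ 𝓝[>] (0 : ℝ)) (clarkeQuotient f h) :=
  IsBoundedUnder.isCoboundedUnder_le ⟨-(L * ‖h‖), eventually_map.2 <|
    (eventually_abs_clarkeQuotient_le hs hL h).mono fun _ hp => (abs_le.1 hp).1⟩

lemma clarkeDirDeriv_le_mul_norm (hs : s ∈ 𝓝 x) (hL : LipschitzOnWith L f s) (h : E) :
    clarkeDirDeriv f x h ≤ L * ‖h‖ :=
  limsup_le_of_le (isCoboundedUnder_le_clarkeQuotient hs hL h) <|
    (eventually_abs_clarkeQuotient_le hs hL h).mono fun _ hp => (abs_le.1 hp).2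

lemma IsLipschitzNear.eventually_clarkeDirDeriv_le (hf : IsLipschitzNear f x) {h : E} {c : ℝ}
    (hc : clarkeDirDeriv f x h < c) : ∀ᶠ y in 𝓝 x, clarkeDirDeriv f y h ≤ c := by
  obtain ⟨L, s, hs, hL⟩ := hf
  obtain ⟨pa, hpa, pb, hpb, hab⟩ := eventually_prod_iff.1 <|
    eventually_lt_of_limsup_lt hc (isBoundedUnder_le_clarkeQuotient hs hL h)
  filter_upwards [eventually_eventually_nhds.2 hpa, eventually_mem_nhds_iff.2 hs] with y hy hys
  refine limsup_le_of_le (isCoboundedUnder_le_clarkeQuotient hys hL h) ?_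
  exact eventually_prod_iff.2 ⟨pa, hy, pb, hpb, fun hx _ hy => (hab hx hy).le⟩

lemma norm_le_of_mem_clarkeGradient (hs : s ∈ 𝓝 x) (hL : LipschitzOnWith L f s)
    (hζ : ζ ∈ clarkeGradient f x) : ‖ζ‖ ≤ L := by
  rcases (norm_nonneg ζ).eq_or_lt with hzero | hpos
  · exact hzero ▸ L.coe_nonneg
  · refine le_of_mul_le_mul_right ?_ hpos
    rw [← real_inner_self_eq_norm_mul_norm]
    exact (hζ ζ).trans (clarkeDirDeriv_le_mul_norm hs hL ζ)

lemma isBounded_biUnion_clarkeGradient (hK : IsCompact K) (hf : ∀ z ∈ K, IsLipschitzNear f z) :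
    Bornology.IsBounded (⋃ z ∈ K, clarkeGradient f z) := by
  refine hK.induction_on (p := fun s => Bornology.IsBounded (⋃ z ∈ s, clarkeGradient f z))
    (by simp) (fun s t hst ht => ht.subset (Set.biUnion_subset_biUnion_left hst))
    (fun s t hs ht => by simpa only [Set.biUnion_union] using hs.union ht) fun z hz => ?_
  obtain ⟨L, s, hs, hL⟩ := hf z hz
  refine ⟨_, nhdsWithin_le_nhds (eventually_mem_nhds_iff.2 hs),
    isBounded_iff_forall_norm_le.2 ⟨L, fun ζ hζ => ?_⟩⟩
  obtain ⟨y, hy, hζ⟩ := Set.mem_iUnion₂.1 hζ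
  exact norm_le_of_mem_clarkeGradient hy hL hζ

lemma mem_stationarySet_iff :
    x ∈ stationarySet f K ↔ x ∈ K ∧ (0 : E) ∈ clarkeGradient f x + normalConeAt K x := by
  refine and_congr_right fun _ => ?_
  simp only [Set.mem_sub, Set.mem_add, Set.mem_neg]
  constructor
  · rintro ⟨ζ, hζ, η, hη, hsum⟩
    exact ⟨-ζ, hζ, η, hη, by rw [neg_add_eq_sub, ← neg_sub, hsum, neg_zero]⟩
  · rintro ⟨ζ, hζ, η, hη, hsum⟩
    exact ⟨-ζ, (neg_neg ζ).symm ▸ hζ, η, hη, by rw [← neg_add', hsum, neg_zero]⟩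

lemma smul_mem_normalConeAt {c : ℝ} (hc : 0 ≤ c) (hη : η ∈ normalConeAt K x) :
    c • η ∈ normalConeAt K x := fun z hz => by
  rw [real_inner_smul_left]
  exact mul_nonpos_of_nonneg_of_nonpos hc (hη z hz)

lemma IsProjectionOnto.sub_mem_normalConeAt {w p : E} (hp : IsProjectionOnto K w p)
    (hK : Convex ℝ K) : w - p ∈ normalConeAt K p := by
  have : Nonempty K := ⟨⟨p, hp.1⟩⟩
  refine (norm_eq_iInf_iff_real_inner_le_zero hK hp.1).1 (le_antisymm ?_ ?_)
  · exact le_ciInf fun z => hp.2 z z.2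
  · exact ciInf_le ⟨0, by rintro _ ⟨y, rfl⟩; exact norm_nonneg _⟩ (⟨p, hp.1⟩ : K)

lemma IsProjectionOnto.exists_normal {a Y p : E} {c : ℝ}
    (hp : IsProjectionOnto K (a - c • Y) p) (hK : Convex ℝ K) (ha : a ∈ K) (hc : 0 < c) :
    ∃ η ∈ normalConeAt K p, ‖η‖ ≤ ‖Y‖ ∧ p = a - c • (Y + η) := by
  refine ⟨c⁻¹ • (a - c • Y - p),
    smul_mem_normalConeAt (inv_nonneg.2 hc.le) (hp.sub_mem_normalConeAt hK), ?_, ?_⟩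
  · have hdist := hp.2 a ha
    rw [sub_sub_cancel_left, norm_neg, norm_smul, Real.norm_of_nonneg hc.le] at hdist
    rwa [norm_smul, norm_inv, Real.norm_of_nonneg hc.le, inv_mul_le_iff₀ hc]
  · rw [smul_add, smul_inv_smul₀ hc.ne']
    abel

lemma IsClarkeRegularAt.hasDerivWithinAt_line (hreg : IsClarkeRegularAt f x) (h : E) (t : ℝ) :
    HasDerivWithinAt (fun r => f (x + (r - t) • h)) (clarkeDirDeriv f x h) (Set.Ioi t) t := by
  rw [hasDerivWithinAt_iff_tendsto_slope' Set.self_notMem_Ioi]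
  have hshift : Tendsto (fun r => r - t) (𝓝[>] t) (𝓝[>] 0) := by
    have hcont : Tendsto (fun r : ℝ => r - t) (𝓝 t) (𝓝 0) :=
      Continuous.tendsto' (by fun_prop) _ _ (sub_self t)
    refine tendsto_nhdsWithin_iff.2 ⟨hcont.mono_left nhdsWithin_le_nhds, ?_⟩
    filter_upwards [self_mem_nhdsWithin] with r (hr : t < r) using sub_pos.2 hr
  refine ((hreg h).comp hshift).congr fun r => ?_
  simp only [Function.comp_apply, slope_def_field, sub_self, zero_smul, add_zero]

lemma IsClarkeRegularAt.hasDerivWithinAt_comp {y : ℝ → E} {t : ℝ} {u : E}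
    (hreg : IsClarkeRegularAt f (y t)) (hf : IsLipschitzNear f (y t))
    (hy : HasDerivWithinAt y u (Set.Ioi t) t) :
    HasDerivWithinAt (fun r => f (y r)) (clarkeDirDeriv f (y t) u) (Set.Ioi t) t := by
  obtain ⟨L, s, hs, hL⟩ := hf
  have hline : Tendsto (fun r => y t + (r - t) • u) (𝓝[>] t) (𝓝 (y t)) :=
    (Continuous.tendsto' (by fun_prop) _ _ (by simp)).mono_left nhdsWithin_le_nhds
  -- `f` is Lipschitz, so replacing `y` by its tangent line changes `f ∘ y` by `o(r - t)` only.
  have hO : (fun r => f (y r) - f (y t + (r - t) • u)) =O[𝓝[>] t]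
      fun r => y r - y t - (r - t) • u := by
    refine Asymptotics.IsBigO.of_bound L ?_
    filter_upwards [hy.continuousWithinAt hs, hline hs] with r hyr hlr
    simpa only [Real.dist_eq, dist_eq_norm, sub_sub] using hL.dist_le_mul _ hyr _ hlr
  refine .of_isLittleO
    (((hO.trans_isLittleO hy.isLittleO).add (hreg.hasDerivWithinAt_line u t).isLittleO).congr_left
      fun r => ?_)
  simp only [sub_self, zero_smul, add_zero]
  ring

lemma inner_eq_zero_of_mem_normalConeAt_of_hasDerivAt {y : ℝ → E} {t : ℝ} {y' : E}
    (hη : η ∈ normalConeAt K (y t)) (hyK : ∀ᶠ r in 𝓝 t, y r ∈ K) (hy : HasDerivAt y y' t) :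
    inner ℝ η y' = 0 := by
  have hmax : IsLocalMax (fun r => inner ℝ η (y r)) t := hyK.mono fun r hr => by
    simpa only [inner_sub_right, sub_nonpos] using hη _ hr
  exact hmax.hasDerivAt_eq_zero ((innerSL ℝ η).hasFDerivAt.comp_hasDerivAt t hy)

lemma IsClarkeRegularAt.deriv_comp_le_neg_sq {y : ℝ → E} {t g' : ℝ} {u : E}
    (hreg : IsClarkeRegularAt f (y t)) (hf : IsLipschitzNear f (y t))
    (hyK : ∀ᶠ r in 𝓝 t, y r ∈ K) (hu : u ∈ clarkeGradient f (y t) + normalConeAt K (y t))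
    (hy : HasDerivAt y (-u) t) (hg : HasDerivAt (fun r => f (y r)) g' t) : g' ≤ -‖u‖ ^ 2 := by
  obtain ⟨ζ, hζ, η, hη, rfl⟩ := Set.mem_add.1 hu
  -- Read backwards in time, `y` leaves `y t` in direction `ζ + η`.
  have hback : clarkeDirDeriv f (y t) (ζ + η) = -g' := by
    have hy_rev : HasDerivAt (fun r => y (t - r)) (ζ + η) 0 :=
      neg_neg (ζ + η) ▸ HasDerivAt.comp_const_sub t 0 ((sub_zero t).symm ▸ hy)
    have hg_rev : HasDerivAt (fun r => f (y (t - r))) (-g') 0 :=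
      HasDerivAt.comp_const_sub (f := fun r => f (y r)) t 0 ((sub_zero t).symm ▸ hg)
    have hchain := IsClarkeRegularAt.hasDerivWithinAt_comp (y := fun r => y (t - r)) (t := 0)
      (by simpa using hreg) (by simpa using hf) hy_rev.hasDerivWithinAt
    simpa using (uniqueDiffWithinAt_Ioi 0).eq_deriv _ hchain hg_rev.hasDerivWithinAt
  have hperp : inner ℝ η (ζ + η) = 0 := by
    simpa [-neg_add_rev] using inner_eq_zero_of_mem_normalConeAt_of_hasDerivAt hη hyK hy
  have hsq : inner ℝ (ζ + η) ζ = ‖ζ + η‖ ^ 2 := by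
    rw [← real_inner_self_eq_norm_sq, inner_add_right (ζ + η), real_inner_comm η, hperp, add_zero]
  linarith [hζ (ζ + η)]

end ClarkeCalculus

section SubgradientFlow

open scoped NNReal

variable {E : Type*} [NormedAddCommGroup E] [InnerProductSpace ℝ E]
  {f : E → ℝ} {K : Set E} {y : ℝ → E}

lemma le_of_absolutelyContinuousOnInterval_of_ae_deriv_nonpos {φ : ℝ → ℝ} {a b : ℝ}
    (hφ : AbsolutelyContinuousOnInterval φ a b) (hab : a ≤ b)
    (hd : ∀ᵐ t, t ∈ Set.Ioc a b → deriv φ t ≤ 0) : φ b ≤ φ a := by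
  have hint : ∫ t in a..b, deriv φ t ≤ 0 := by
    rw [intervalIntegral.integral_of_le hab]
    refine MeasureTheory.integral_nonpos_of_ae ?_
    exact (MeasureTheory.ae_restrict_iff' measurableSet_Ioc).2 hd
  linarith [hφ.integral_deriv_eq_sub]

/-- A solution on `[0, ∞)` of the differential inclusion `y' ∈ -∂̄f(y) - N_K(y)`. Solutions are
taken Lipschitz rather than absolutely continuous, and are extended to negative times by any
Lipschitz curve in `K`. -/
structure IsSubgradientFlow (f : E → ℝ) (K : Set E) (y : ℝ → E) : Prop where
  mem : ∀ t, y t ∈ K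
  lipschitz : ∃ L : ℝ≥0, LipschitzWith L y
  hasDerivAt : ∀ᵐ t, 0 < t →
    ∃ u ∈ clarkeGradient f (y t) + normalConeAt K (y t), HasDerivAt y (-u) t

namespace IsSubgradientFlow

lemma exists_lipschitzWith_comp (hy : IsSubgradientFlow f K y) (hK : IsCompact K)
    (hf : ∀ z ∈ K, IsLipschitzNear f z) : ∃ L : ℝ≥0, LipschitzWith L (fun t => f (y t)) := by
  obtain ⟨M, hM⟩ := hy.lipschitz
  obtain ⟨L, hL⟩ :=
    (locallyLipschitzOn_of_isLipschitzNear hf).exists_lipschitzOnWith_of_compact hK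
  exact ⟨L * M, lipschitzOnWith_univ.1 (hL.comp hM.lipschitzOnWith fun t _ => hy.mem t)⟩

lemma ae_deriv_comp_le_neg_sq (hy : IsSubgradientFlow f K y) (hK : IsCompact K)
    (hf : ∀ z ∈ K, IsLipschitzNear f z) (hreg : ∀ z ∈ K, IsClarkeRegularAt f z) :
    ∀ᵐ t, 0 < t → ∃ u ∈ clarkeGradient f (y t) + normalConeAt K (y t),
      HasDerivAt y (-u) t ∧ deriv (fun r => f (y r)) t ≤ -‖u‖ ^ 2 := by
  obtain ⟨L, hL⟩ := hy.exists_lipschitzWith_comp hK hf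
  filter_upwards [hy.hasDerivAt, hL.ae_differentiableAt_real] with t hyt hft ht
  obtain ⟨u, hu, hyu⟩ := hyt ht
  exact ⟨u, hu, hyu, (hreg _ (hy.mem t)).deriv_comp_le_neg_sq (hf _ (hy.mem t))
    (Eventually.of_forall hy.mem) hu hyu hft.hasDerivAt⟩

lemma antitoneOn_comp (hy : IsSubgradientFlow f K y) (hK : IsCompact K)
    (hf : ∀ z ∈ K, IsLipschitzNear f z) (hreg : ∀ z ∈ K, IsClarkeRegularAt f z) :
    AntitoneOn (fun t => f (y t)) (Set.Ici 0) := by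
  intro a (ha : 0 ≤ a) b _ hab
  obtain ⟨L, hL⟩ := hy.exists_lipschitzWith_comp hK hf
  refine le_of_absolutelyContinuousOnInterval_of_ae_deriv_nonpos
    hL.lipschitzOnWith.absolutelyContinuousOnInterval hab ?_
  filter_upwards [hy.ae_deriv_comp_le_neg_sq hK hf hreg] with t ht htab
  obtain ⟨u, -, -, hle⟩ := ht (ha.trans_lt htab.1)
  exact hle.trans (neg_nonpos.2 (sq_nonneg _))

theorem comp_lt_of_notMem_stationarySet (hy : IsSubgradientFlow f K y) (hK : IsCompact K)
    (hf : ∀ z ∈ K, IsLipschitzNear f z) (hreg : ∀ z ∈ K, IsClarkeRegularAt f z)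
    (h0 : y 0 ∉ stationarySet f K) {τ : ℝ} (hτ : 0 < τ) : f (y τ) < f (y 0) := by
  by_contra! hle
  have hanti := hy.antitoneOn_comp hK hf hreg
  have hconst : ∀ t ∈ Set.Ioo 0 τ, f (y t) = f (y 0) := fun t ht =>
    le_antisymm (hanti Set.self_mem_Ici ht.1.le ht.1.le)
      (hle.trans (hanti ht.1.le hτ.le ht.2.le))
  have hrest : ∀ᵐ t, t ∈ Set.Ioo 0 τ →
      HasDerivAt y 0 t ∧ (0 : E) ∈ clarkeGradient f (y t) + normalConeAt K (y t) := by
    filter_upwards [hy.ae_deriv_comp_le_neg_sq hK hf hreg] with t ht htτ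
    obtain ⟨u, hu, hyu, hle⟩ := ht htτ.1
    have hderiv : deriv (fun r => f (y r)) t = 0 := by
      refine ((hasDerivAt_const t (f (y 0))).congr_of_eventuallyEq ?_).deriv
      filter_upwards [isOpen_Ioo.mem_nhds htτ] using hconst
    obtain rfl : u = 0 := by
      rw [← norm_eq_zero, ← sq_eq_zero_iff]
      exact le_antisymm (by linarith) (sq_nonneg _)
    exact ⟨neg_zero (G := E) ▸ hyu, hu⟩
  obtain ⟨t, ht, htτ⟩ := (MeasureTheory.Measure.dense_of_ae hrest).exists_mem_open isOpen_Ioo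
    (Set.nonempty_Ioo.2 hτ)
  obtain ⟨L, hL⟩ := hy.lipschitz
  obtain ⟨c, hc⟩ := (hL.lipschitzOnWith (s := Set.uIcc 0 t)).absolutelyContinuousOnInterval
    |>.const_of_ae_hasDerivAt_zero <| by
      filter_upwards [hrest, MeasureTheory.Measure.ae_ne _ 0] with r hr hr0 hrt
      rw [Set.uIcc_of_le htτ.1.le] at hrt
      exact (hr ⟨hrt.1.lt_of_ne' hr0, hrt.2.trans_lt htτ.2⟩).1
  have hy0 : y t = y 0 := (hc t Set.right_mem_uIcc).trans (hc 0 Set.left_mem_uIcc).symm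
  exact h0 (mem_stationarySet_iff.2 ⟨hy.mem 0, hy0 ▸ (ht htτ).2⟩)

end IsSubgradientFlow

end SubgradientFlow

section Windows

open scoped NNReal

/-- The time reached after `n` steps of lengths `γ 0, γ 1, …`. -/
def stepTime (γ : ℕ → ℝ) (n : ℕ) : ℝ := ∑ i ∈ Finset.range n, γ i

/-- The first index `k ≥ n` at which at least the time `t` has passed since step `n` (`0` if
there is none). -/
noncomputable def windowEnd (γ : ℕ → ℝ) (n : ℕ) (t : ℝ) : ℕ :=
  sInf {k | n ≤ k ∧ stepTime γ n + t ≤ stepTime γ k}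

/-- Step lengths which tend to zero but add up to infinity. -/
structure IsStepSize (γ : ℕ → ℝ) : Prop where
  nonneg : ∀ k, 0 ≤ γ k
  tendsto_stepTime : Tendsto (stepTime γ) atTop atTop
  tendsto_zero : Tendsto γ atTop (𝓝 0)

variable {γ : ℕ → ℝ} {m n : ℕ} {s t : ℝ}

lemma stepTime_succ (γ : ℕ → ℝ) (k : ℕ) : stepTime γ (k + 1) = stepTime γ k + γ k :=
  Finset.sum_range_succ _ _

lemma sum_Ico_eq_stepTime_sub (γ : ℕ → ℝ) (hmn : m ≤ n) :
    ∑ k ∈ Finset.Ico m n, γ k = stepTime γ n - stepTime γ m :=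
  Finset.sum_Ico_eq_sub _ hmn

lemma stepTime_lt_of_lt_windowEnd (hnm : n ≤ m) (hm : m < windowEnd γ n t) :
    stepTime γ m < stepTime γ n + t := by
  by_contra! hle
  exact Nat.notMem_of_lt_sInf hm ⟨hnm, hle⟩

lemma windowEnd_of_nonpos (ht : t ≤ 0) (n : ℕ) : windowEnd γ n t = n := by
  refine le_antisymm (Nat.sInf_le ⟨le_rfl, by linarith⟩) ?_
  exact le_csInf ⟨n, le_rfl, by linarith⟩ fun k hk => hk.1

lemma dist_le_mul_stepTime_sub {α : Type*} [PseudoMetricSpace α] {x : ℕ → α} {C : ℝ}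
    (hx : ∀ k, dist (x k) (x (k + 1)) ≤ C * γ k) (hmn : m ≤ n) :
    dist (x m) (x n) ≤ C * (stepTime γ n - stepTime γ m) := by
  rw [← sum_Ico_eq_stepTime_sub γ hmn, Finset.mul_sum]
  exact dist_le_Ico_sum_of_dist_le hmn fun _ _ => hx _

namespace IsStepSize

lemma monotone_stepTime (hγ : IsStepSize γ) : Monotone (stepTime γ) :=
  monotone_nat_of_le_succ fun k => by
    rw [stepTime_succ]
    exact le_add_of_nonneg_right (hγ.nonneg k)

lemma windowEnd_mem (hγ : IsStepSize γ) (n : ℕ) (t : ℝ) :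
    n ≤ windowEnd γ n t ∧ stepTime γ n + t ≤ stepTime γ (windowEnd γ n t) :=
  Nat.sInf_mem (s := {k | n ≤ k ∧ stepTime γ n + t ≤ stepTime γ k})
    ((eventually_ge_atTop n).and (hγ.tendsto_stepTime.eventually_ge_atTop _)).exists

lemma lt_windowEnd (hγ : IsStepSize γ) (n : ℕ) (ht : 0 < t) : n < windowEnd γ n t := by
  obtain ⟨hn, hle⟩ := hγ.windowEnd_mem n t
  refine hn.lt_of_ne fun heq => ?_
  rw [← heq] at hle
  linarith

lemma monotone_windowEnd (hγ : IsStepSize γ) (n : ℕ) : Monotone (windowEnd γ n) := fun s t hst =>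
  let ⟨hn, hle⟩ := hγ.windowEnd_mem n t
  Nat.sInf_le ⟨hn, by linarith⟩

lemma tendsto_windowEnd (hγ : IsStepSize γ) (t : ℝ) :
    Tendsto (fun n => windowEnd γ n t) atTop atTop :=
  tendsto_atTop_mono (fun n => (hγ.windowEnd_mem n t).1) tendsto_id

lemma stepTime_windowEnd_le (hγ : IsStepSize γ) (n : ℕ) (ht : 0 < t) :
    stepTime γ (windowEnd γ n t) ≤ stepTime γ n + t + γ (windowEnd γ n t - 1) := by
  obtain ⟨m, hm⟩ := Nat.exists_eq_add_one_of_ne_zero (hγ.lt_windowEnd n ht).ne_bot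
  have hnm : n ≤ m := Nat.le_of_lt_add_one (hm ▸ hγ.lt_windowEnd n ht)
  have hlt : stepTime γ m < stepTime γ n + t := stepTime_lt_of_lt_windowEnd hnm (by omega)
  rw [hm, stepTime_succ, Nat.add_sub_cancel]
  linarith

lemma tendsto_stepTime_windowEnd_sub (hγ : IsStepSize γ) (t : ℝ) :
    Tendsto (fun n => stepTime γ (windowEnd γ n t) - stepTime γ n) atTop (𝓝 (max t 0)) := by
  rcases le_or_gt t 0 with ht | ht
  · simp [windowEnd_of_nonpos ht, ht]
  have hlast : Tendsto (fun n => t + γ (windowEnd γ n t - 1)) atTop (𝓝 t) := by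
    simpa using ((hγ.tendsto_zero.comp
      ((tendsto_sub_atTop_nat 1).comp (hγ.tendsto_windowEnd t))).const_add t)
  rw [max_eq_left ht.le]
  refine tendsto_of_tendsto_of_tendsto_of_le_of_le tendsto_const_nhds hlast
    (fun n => ?_) (fun n => ?_)
  · linarith [(hγ.windowEnd_mem n t).2]
  · linarith [hγ.stepTime_windowEnd_le n ht]

lemma tendsto_stepTime_windowEnd_sub_windowEnd (hγ : IsStepSize γ) (s t : ℝ) :
    Tendsto (fun n => stepTime γ (windowEnd γ n t) - stepTime γ (windowEnd γ n s)) atTop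
      (𝓝 (max t 0 - max s 0)) := by
  simpa using (hγ.tendsto_stepTime_windowEnd_sub t).sub (hγ.tendsto_stepTime_windowEnd_sub s)

lemma eventually_forall_mem_window {α : Type*} [PseudoMetricSpace α] (hγ : IsStepSize γ)
    {x : ℕ → α} {C : ℝ≥0} (hx : ∀ k, dist (x k) (x (k + 1)) ≤ C * γ k) {U : Filter ℕ}
    (hU : U ≤ atTop) (hs : 0 ≤ s) {p : α} (hp : Tendsto (fun n => x (windowEnd γ n s)) U (𝓝 p))
    {O : Set α} (hO : O ∈ 𝓝 p) :
    ∀ᶠ t in 𝓝[>] s, ∀ᶠ n in U,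
      ∀ k ∈ Finset.Icc (windowEnd γ n s) (windowEnd γ n t), x k ∈ O := by
  obtain ⟨ε, hε, hεO⟩ := Metric.mem_nhds_iff.1 hO
  have hshort : ∀ᶠ t in 𝓝[>] s, C * (t - s) < ε / 2 := by
    have : Tendsto (fun t => C * (t - s)) (𝓝 s) (𝓝 0) :=
      Continuous.tendsto' (by fun_prop) _ _ (by simp)
    exact (this.mono_left nhdsWithin_le_nhds).eventually_lt_const (half_pos hε)
  filter_upwards [hshort, self_mem_nhdsWithin] with t ht (hst : s < t)
  have hdur := ((hγ.tendsto_stepTime_windowEnd_sub_windowEnd s t).mono_left hU).const_mul (C : ℝ)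
  rw [max_eq_left hs, max_eq_left (hs.trans hst.le)] at hdur
  filter_upwards [hdur.eventually_lt_const ht, hp (Metric.ball_mem_nhds p (half_pos hε))]
    with n hn (hstart : dist (x (windowEnd γ n s)) p < ε / 2) k hk
  obtain ⟨hsk, hkt⟩ := Finset.mem_Icc.1 hk
  refine hεO (Metric.mem_ball.2 ?_)
  calc dist (x k) p
      ≤ dist (x (windowEnd γ n s)) (x k) + dist (x (windowEnd γ n s)) p := dist_triangle_left _ _ _
    _ ≤ C * (stepTime γ k - stepTime γ (windowEnd γ n s)) + dist (x (windowEnd γ n s)) p := by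
      gcongr
      exact dist_le_mul_stepTime_sub hx hsk
    _ ≤ C * (stepTime γ (windowEnd γ n t) - stepTime γ (windowEnd γ n s)) +
        dist (x (windowEnd γ n s)) p := by
      gcongr
      exact hγ.monotone_stepTime hkt
    _ < ε := by linarith

end IsStepSize

end Windows

section LimitCurves

open scoped NNReal

variable {γ : ℕ → ℝ} {U : Filter ℕ} {F : Type*} [NormedAddCommGroup F] [NormedSpace ℝ F]
  {w w₁ w₂ : ℕ → F} {A A₁ A₂ : ℝ → F} {C : ℝ≥0}

/-- `A t` is, for every `t`, the limit along `U` of the sums of `γ k • w k` over the windows of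
duration `t` starting at `n`. -/
def IsLimitCurve (γ : ℕ → ℝ) (w : ℕ → F) (U : Filter ℕ) (A : ℝ → F) : Prop :=
  ∀ t, Tendsto (fun n => ∑ k ∈ Finset.Ico n (windowEnd γ n t), γ k • w k) U (𝓝 (A t))

namespace IsStepSize

lemma norm_sum_Ico_smul_le (hγ : IsStepSize γ) {c : ℝ} {m n : ℕ} (hmn : m ≤ n)
    (hw : ∀ k ∈ Finset.Ico m n, ‖w k‖ ≤ c) :
    ‖∑ k ∈ Finset.Ico m n, γ k • w k‖ ≤ c * (stepTime γ n - stepTime γ m) := by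
  rw [← sum_Ico_eq_stepTime_sub γ hmn, Finset.mul_sum]
  refine norm_sum_le_of_le _ fun k hk => ?_
  rw [norm_smul, Real.norm_of_nonneg (hγ.nonneg k), mul_comm]
  exact mul_le_mul_of_nonneg_right (hw k hk) (hγ.nonneg k)

lemma inner_sum_Ico_smul_le {E : Type*} [NormedAddCommGroup E] [InnerProductSpace ℝ E]
    (hγ : IsStepSize γ) {w : ℕ → E} {u : E} {c : ℝ} {m n : ℕ} (hmn : m ≤ n)
    (hw : ∀ k ∈ Finset.Ico m n, inner ℝ u (w k) ≤ c) :
    inner ℝ u (∑ k ∈ Finset.Ico m n, γ k • w k) ≤ c * (stepTime γ n - stepTime γ m) := by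
  rw [← sum_Ico_eq_stepTime_sub γ hmn, Finset.mul_sum, inner_sum]
  refine Finset.sum_le_sum fun k hk => ?_
  rw [real_inner_smul_right, mul_comm]
  exact mul_le_mul_of_nonneg_right (hw k hk) (hγ.nonneg k)

lemma isLimitCurve_zero_of_tendsto_sum (hγ : IsStepSize γ) {S : F}
    (hw : Tendsto (fun n => ∑ k ∈ Finset.range n, γ k • w k) atTop (𝓝 S)) :
    IsLimitCurve γ w atTop 0 := fun t => by
  refine (sub_self S ▸ (hw.comp (hγ.tendsto_windowEnd t)).sub hw).congr fun n => ?_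
  exact (Finset.sum_Ico_eq_sub _ (hγ.windowEnd_mem n t).1).symm

lemma isLimitCurve_zero_of_tendsto_zero (hγ : IsStepSize γ) (hw : Tendsto w atTop (𝓝 0)) :
    IsLimitCurve γ w atTop 0 := fun t => by
  refine NormedAddGroup.tendsto_nhds_zero.2 fun ε hε => ?_
  have hT : 0 < max t 0 + 1 := by positivity
  filter_upwards [(hγ.tendsto_stepTime_windowEnd_sub t).eventually_lt_const (lt_add_one _),
    eventually_forall_ge_atTop.2 (NormedAddGroup.tendsto_nhds_zero.1 hw _ (div_pos hε hT))]
    with n hdur hsmall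
  calc ‖∑ k ∈ Finset.Ico n (windowEnd γ n t), γ k • w k‖
      ≤ ε / (max t 0 + 1) * (stepTime γ (windowEnd γ n t) - stepTime γ n) :=
        hγ.norm_sum_Ico_smul_le (hγ.windowEnd_mem n t).1 fun k hk =>
          (hsmall k (Finset.mem_Ico.1 hk).1).le
    _ < ε / (max t 0 + 1) * (max t 0 + 1) := by gcongr
    _ = ε := div_mul_cancel₀ _ hT.ne'

end IsStepSize

namespace IsLimitCurve

lemma add (h₁ : IsLimitCurve γ w₁ U A₁) (h₂ : IsLimitCurve γ w₂ U A₂) :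
    IsLimitCurve γ (w₁ + w₂) U (A₁ + A₂) := fun t => by
  simpa only [Pi.add_apply, smul_add, Finset.sum_add_distrib] using (h₁ t).add (h₂ t)

lemma map_zero [U.NeBot] (hA : IsLimitCurve γ w U A) : A 0 = 0 := by
  have h0 := hA 0
  simp only [windowEnd_of_nonpos le_rfl, Finset.Ico_self, Finset.sum_empty] at h0
  exact tendsto_nhds_unique h0 tendsto_const_nhds

lemma tendsto_sub (hA : IsLimitCurve γ w U A) (hγ : IsStepSize γ) {s t : ℝ} (hst : s ≤ t) :
    Tendsto (fun n => ∑ k ∈ Finset.Ico (windowEnd γ n s) (windowEnd γ n t), γ k • w k) U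
      (𝓝 (A t - A s)) := by
  refine ((hA t).sub (hA s)).congr fun n => ?_
  rw [sub_eq_iff_eq_add', Finset.sum_Ico_consecutive _ (hγ.windowEnd_mem n s).1
    (hγ.monotone_windowEnd n hst)]

lemma lipschitzWith [U.NeBot] (hA : IsLimitCurve γ w U A) (hγ : IsStepSize γ) (hU : U ≤ atTop)
    (hw : ∀ k, ‖w k‖ ≤ C) : LipschitzWith C A := by
  refine LipschitzWith.of_dist_le_mul fun t s => ?_
  wlog hst : s ≤ t generalizing s t
  · rw [dist_comm, dist_comm t]
    exact this s t (le_of_not_ge hst)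
  have hdur := ((hγ.tendsto_stepTime_windowEnd_sub_windowEnd s t).mono_left hU).const_mul (C : ℝ)
  have hnorm : ‖A t - A s‖ ≤ C * (max t 0 - max s 0) :=
    le_of_tendsto_of_tendsto (hA.tendsto_sub hγ hst).norm hdur <| Eventually.of_forall fun n =>
      hγ.norm_sum_Ico_smul_le (hγ.monotone_windowEnd n hst) fun k _ => hw k
  rw [dist_eq_norm, Real.dist_eq]
  exact hnorm.trans <| mul_le_mul_of_nonneg_left
    ((le_abs_self _).trans (abs_max_sub_max_le_abs t s 0)) C.coe_nonneg

lemma inner_deriv_le {E : Type*} [NormedAddCommGroup E] [InnerProductSpace ℝ E] [U.NeBot]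
    {w : ℕ → E} {A : ℝ → E} (hA : IsLimitCurve γ w U A) (hγ : IsStepSize γ) (hU : U ≤ atTop)
    {s : ℝ} (hs : 0 ≤ s) {a : E} (ha : HasDerivAt A a s) {u : E} {c : ℝ}
    (hc : ∀ᶠ t in 𝓝[>] s, ∀ᶠ n in U,
      ∀ k ∈ Finset.Ico (windowEnd γ n s) (windowEnd γ n t), inner ℝ u (w k) ≤ c) :
    inner ℝ u a ≤ c := by
  have hslope : Tendsto (fun t => inner ℝ u (slope A s t)) (𝓝[>] s) (𝓝 (inner ℝ u a)) :=
    tendsto_const_nhds.inner (hasDerivAt_iff_tendsto_slope_left_right.1 ha).2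
  refine le_of_tendsto hslope ?_
  filter_upwards [hc, self_mem_nhdsWithin] with t ht (hst : s < t)
  have hincr : inner ℝ u (A t - A s) ≤ c * (t - s) := by
    have hdur := ((hγ.tendsto_stepTime_windowEnd_sub_windowEnd s t).mono_left hU).const_mul c
    rw [max_eq_left hs, max_eq_left (hs.trans hst.le)] at hdur
    refine le_of_tendsto_of_tendsto (tendsto_const_nhds.inner (hA.tendsto_sub hγ hst.le)) hdur ?_
    filter_upwards [ht] with n hn
    exact hγ.inner_sum_Ico_smul_le (hγ.monotone_windowEnd n hst.le) hn
  rwa [slope_def_module, real_inner_smul_right, inv_mul_le_iff₀ (sub_pos.2 hst), mul_comm]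

end IsLimitCurve

lemma exists_isLimitCurve [ProperSpace F] (hγ : IsStepSize γ) (hw : ∀ k, ‖w k‖ ≤ C)
    {U : Ultrafilter ℕ} (hU : (U : Filter ℕ) ≤ atTop) :
    ∃ A : ℝ → F, IsLimitCurve γ w (U : Filter ℕ) A := by
  suffices ∀ t, ∃ a,
      Tendsto (fun n => ∑ k ∈ Finset.Ico n (windowEnd γ n t), γ k • w k) U (𝓝 a) by
    choose A hA using this
    exact ⟨A, hA⟩
  intro t
  have hbdd : ∀ᶠ n in (U : Filter ℕ), ∑ k ∈ Finset.Ico n (windowEnd γ n t), γ k • w k ∈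
      Metric.closedBall (0 : F) (C * (max t 0 + 1)) := by
    filter_upwards [((hγ.tendsto_stepTime_windowEnd_sub t).mono_left hU).eventually_lt_const
      (lt_add_one _)] with n hn
    rw [mem_closedBall_zero_iff]
    refine (hγ.norm_sum_Ico_smul_le (hγ.windowEnd_mem n t).1 fun k _ => hw k).trans ?_
    exact mul_le_mul_of_nonneg_left hn.le C.coe_nonneg
  obtain ⟨a, -, ha⟩ := (isCompact_closedBall (0 : F) _).ultrafilter_le_nhds (U.map _)
    (le_principal_iff.2 hbdd)
  exact ⟨a, ha⟩

end LimitCurves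

section Upcrossings

open scoped NNReal

variable {a γ : ℕ → ℝ} {c d τ : ℝ} {n : ℕ}

/-- The sequence `a` is at most `c` at time `n` and then stays above `c` at least until it has
exceeded `d`. -/
def IsUpcrossingStart (a : ℕ → ℝ) (c d : ℝ) (n : ℕ) : Prop :=
  a n ≤ c ∧ ∃ N > n, d < a N ∧ ∀ k ∈ Set.Ioc n N, c < a k

lemma frequently_isUpcrossingStart (hcd : c ≤ d) (hlow : ∃ᶠ n in atTop, a n ≤ c)
    (hhigh : ∃ᶠ n in atTop, d < a n) : ∃ᶠ n in atTop, IsUpcrossingStart a c d n := by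
  rw [frequently_atTop]
  intro n₀
  obtain ⟨m, hm, hmc⟩ := frequently_atTop.1 hlow n₀
  obtain ⟨N, hmN, hNd⟩ := frequently_atTop.1 hhigh m
  have hlast : a (Nat.findGreatest (a · ≤ c) N) ≤ c :=
    Nat.findGreatest_spec (P := (a · ≤ c)) hmN hmc
  refine ⟨Nat.findGreatest (a · ≤ c) N, hm.trans (Nat.le_findGreatest hmN hmc), hlast, N,
    (Nat.findGreatest_le N).lt_of_ne fun heq => ?_, hNd,
    fun k hk => not_le.1 (Nat.findGreatest_is_greatest hk.1 hk.2)⟩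
  rw [heq] at hlast
  linarith

lemma tendsto_of_eventually_isUpcrossingStart {U : Filter ℕ}
    (hU : ∀ᶠ n in U, IsUpcrossingStart a c d n)
    (ha : Tendsto (fun n => a (n + 1) - a n) U (𝓝 0)) : Tendsto a U (𝓝 c) := by
  have hlower : Tendsto (fun n => c - (a (n + 1) - a n)) U (𝓝 c) := by
    simpa using ha.const_sub c
  refine tendsto_of_tendsto_of_tendsto_of_le_of_le' hlower tendsto_const_nhds ?_
    (hU.mono fun n hn => hn.1)
  filter_upwards [hU] with n ⟨_, N, hnN, _, habove⟩
  linarith [habove (n + 1) ⟨n.lt_succ_self, hnN⟩]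

lemma IsUpcrossingStart.lt_apply_windowEnd {B : ℝ≥0} (hn : IsUpcrossingStart a c d n)
    (hγ : IsStepSize γ) (ha : ∀ k, dist (a k) (a (k + 1)) ≤ B * γ k) (hτ : 0 < τ)
    (hshort : B * (stepTime γ (windowEnd γ n τ) - stepTime γ n) ≤ d - c) :
    c < a (windowEnd γ n τ) := by
  obtain ⟨hnc, N, hnN, hNd, habove⟩ := hn
  refine habove _ ⟨hγ.lt_windowEnd n hτ, ?_⟩
  by_contra! hlt
  have hrise : d - c < B * (stepTime γ (windowEnd γ n τ) - stepTime γ n) :=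
    calc d - c < a N - a n := by linarith
      _ ≤ dist (a n) (a N) := by rw [dist_comm]; exact le_abs_self _
      _ ≤ B * (stepTime γ N - stepTime γ n) := dist_le_mul_stepTime_sub ha hnN.le
      _ ≤ _ := by
        gcongr
        exact hγ.monotone_stepTime hlt.le
  exact hrise.not_ge hshort

end Upcrossings

section Scheme

open scoped NNReal

variable {E : Type*} [NormedAddCommGroup E] [InnerProductSpace ℝ E]

/-- A discretization of `y' ∈ -∂̄f(y) - N_K(y)` with step lengths `γ` and iterates `x` in `K`. The
gradient `v k` is evaluated at `x k` (explicitly), the normal `η k` at `x (k + 1)` (implicitly, as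
a projection does). The perturbation `ν` is only required to cancel out over windows of bounded
duration. -/
structure IsSubgradientScheme (f : E → ℝ) (K : Set E) (C : ℝ≥0) (γ : ℕ → ℝ)
    (x v η ν : ℕ → E) : Prop where
  isStepSize : IsStepSize γ
  mem : ∀ k, x k ∈ K
  grad : ∀ k, v k ∈ clarkeGradient f (x k)
  normal : ∀ k, η k ∈ normalConeAt K (x (k + 1))
  norm_grad : ∀ k, ‖v k‖ ≤ C
  norm_normal : ∀ k, ‖η k‖ ≤ C
  dist_step : ∀ k, dist (x k) (x (k + 1)) ≤ C * γ k
  step : ∀ k, x (k + 1) = x k - γ k • (v k + η k + ν k)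
  noise : IsLimitCurve γ ν atTop 0

namespace IsSubgradientScheme

variable {f : E → ℝ} {K : Set E} {C : ℝ≥0} {γ : ℕ → ℝ} {x v η ν : ℕ → E}

lemma eq_sub_sum (h : IsSubgradientScheme f K C γ x v η ν) {m n : ℕ} (hmn : m ≤ n) :
    x n = x m - ∑ k ∈ Finset.Ico m n, γ k • v k - ∑ k ∈ Finset.Ico m n, γ k • η k -
      ∑ k ∈ Finset.Ico m n, γ k • ν k := by
  induction n, hmn using Nat.le_induction with
  | base => simp
  | succ k hk ih =>
    simp only [h.step, ih, Finset.sum_Ico_succ_top hk, smul_add]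
    abel

lemma mem_clarkeGradient_of_hasDerivAt (h : IsSubgradientScheme f K C γ x v η ν)
    {U : Filter ℕ} [U.NeBot] (hU : U ≤ atTop) {V : ℝ → E} (hV : IsLimitCurve γ v U V)
    {s : ℝ} (hs : 0 ≤ s) {p ζ : E} (hf : IsLipschitzNear f p)
    (hp : Tendsto (fun n => x (windowEnd γ n s)) U (𝓝 p)) (hζ : HasDerivAt V ζ s) :
    ζ ∈ clarkeGradient f p := by
  refine fun u => le_of_forall_gt_imp_ge_of_dense fun c hc => ?_
  refine hV.inner_deriv_le h.isStepSize hU hs hζ ?_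
  filter_upwards [h.isStepSize.eventually_forall_mem_window h.dist_step hU hs hp
    (hf.eventually_clarkeDirDeriv_le hc)] with t ht
  filter_upwards [ht] with n hn k hk
  exact (h.grad k u).trans (hn k (Finset.Ico_subset_Icc_self hk))

lemma mem_normalConeAt_of_hasDerivAt (h : IsSubgradientScheme f K C γ x v η ν)
    {U : Filter ℕ} [U.NeBot] (hU : U ≤ atTop) {H : ℝ → E} (hH : IsLimitCurve γ η U H)
    {s : ℝ} (hs : 0 ≤ s) {p ξ : E} (hp : Tendsto (fun n => x (windowEnd γ n s)) U (𝓝 p))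
    (hξ : HasDerivAt H ξ s) : ξ ∈ normalConeAt K p := by
  refine fun z hz => le_of_forall_gt_imp_ge_of_dense fun c hc => ?_
  rw [real_inner_comm]
  refine hH.inner_deriv_le h.isStepSize hU hs hξ ?_
  have hnear : ∀ᶠ y in 𝓝 p, C * ‖y - p‖ < c :=
    (Continuous.tendsto' (by fun_prop) p 0 (by simp)).eventually_lt_const hc
  filter_upwards [h.isStepSize.eventually_forall_mem_window h.dist_step hU hs hp hnear] with t ht
  filter_upwards [ht] with n hn k hk
  have hwindow : k + 1 ∈ Finset.Icc (windowEnd γ n s) (windowEnd γ n t) :=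
    Finset.mem_Icc.2 ⟨(Finset.mem_Ico.1 hk).1.trans k.le_succ, (Finset.mem_Ico.1 hk).2⟩
  calc inner ℝ (z - p) (η k)
      = inner ℝ (η k) (z - x (k + 1)) + inner ℝ (η k) (x (k + 1) - p) := by
        rw [← inner_add_right, sub_add_sub_cancel, real_inner_comm]
    _ ≤ 0 + ‖η k‖ * ‖x (k + 1) - p‖ := add_le_add (h.normal k z hz) (real_inner_le_norm _ _)
    _ ≤ C * ‖x (k + 1) - p‖ := by
        rw [zero_add]
        exact mul_le_mul_of_nonneg_right (h.norm_normal k) (norm_nonneg _)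
    _ ≤ c := (hn _ hwindow).le

theorem exists_isSubgradientFlow [FiniteDimensional ℝ E] (h : IsSubgradientScheme f K C γ x v η ν)
    (hK : IsClosed K) (hf : ∀ z ∈ K, IsLipschitzNear f z) {U : Ultrafilter ℕ}
    (hU : (U : Filter ℕ) ≤ atTop) {p : E} (hp : Tendsto x U (𝓝 p)) :
    ∃ y : ℝ → E, IsSubgradientFlow f K y ∧ y 0 = p ∧
      ∀ t, Tendsto (fun n => x (windowEnd γ n t)) U (𝓝 (y t)) := by
  obtain ⟨V, hV⟩ := exists_isLimitCurve h.isStepSize h.norm_grad hU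
  obtain ⟨H, hH⟩ := exists_isLimitCurve h.isStepSize h.norm_normal hU
  have hVL := hV.lipschitzWith h.isStepSize hU h.norm_grad
  have hHL := hH.lipschitzWith h.isStepSize hU h.norm_normal
  have hlim (t : ℝ) : Tendsto (fun n => x (windowEnd γ n t)) U (𝓝 (p - V t - H t)) := by
    have hsums := ((hp.sub (hV t)).sub (hH t)).sub ((h.noise t).mono_left hU)
    rw [Pi.zero_apply, sub_zero] at hsums
    exact hsums.congr fun n => (h.eq_sub_sum (h.isStepSize.windowEnd_mem n t).1).symm
  have hmem (t : ℝ) : p - V t - H t ∈ K :=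
    hK.mem_of_tendsto (hlim t) (Eventually.of_forall fun n => h.mem _)
  refine ⟨fun t => p - V t - H t, ⟨hmem, ⟨_, ((LipschitzWith.const p).sub hVL).sub hHL⟩, ?_⟩,
    by simp only [hV.map_zero, hH.map_zero, sub_zero], hlim⟩
  filter_upwards [hVL.ae_differentiableAt_real, hHL.ae_differentiableAt_real] with t hVt hHt ht
  refine ⟨deriv V t + deriv H t, Set.add_mem_add ?_ ?_, ?_⟩
  · exact h.mem_clarkeGradient_of_hasDerivAt hU hV ht.le (hf _ (hmem t)) (hlim t) hVt.hasDerivAt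
  · exact h.mem_normalConeAt_of_hasDerivAt hU hH ht.le (hlim t) hHt.hasDerivAt
  · rw [neg_add']
    exact (hVt.hasDerivAt.const_sub p).sub hHt.hasDerivAt

lemma exists_dist_comp_le (h : IsSubgradientScheme f K C γ x v η ν) (hK : IsCompact K)
    (hf : ∀ z ∈ K, IsLipschitzNear f z) :
    ∃ B : ℝ≥0, ∀ k, dist (f (x k)) (f (x (k + 1))) ≤ B * γ k := by
  obtain ⟨L, hL⟩ :=
    (locallyLipschitzOn_of_isLipschitzNear hf).exists_lipschitzOnWith_of_compact hK
  refine ⟨L * C, fun k => (hL.dist_le_mul _ (h.mem k) _ (h.mem _)).trans ?_⟩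
  rw [NNReal.coe_mul, mul_assoc]
  exact mul_le_mul_of_nonneg_left (h.dist_step k) L.coe_nonneg

lemma exists_tendsto (h : IsSubgradientScheme f K C γ x v η ν) (hK : IsCompact K)
    (U : Ultrafilter ℕ) : ∃ p ∈ K, Tendsto x U (𝓝 p) :=
  hK.ultrafilter_le_nhds (U.map x) (le_principal_iff.2 (mem_map.2 (univ_mem' h.mem)))

theorem not_frequently_upcrossing [FiniteDimensional ℝ E]
    (h : IsSubgradientScheme f K C γ x v η ν) (hK : IsCompact K)
    (hf : ∀ z ∈ K, IsLipschitzNear f z) (hreg : ∀ z ∈ K, IsClarkeRegularAt f z) {c d : ℝ}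
    (hcd : c < d) (hc : c ∉ f '' stationarySet f K) (hlow : ∃ᶠ n in atTop, f (x n) ≤ c) :
    ¬ ∃ᶠ n in atTop, d < f (x n) := by
  intro hhigh
  obtain ⟨B, hB⟩ := h.exists_dist_comp_le hK hf
  have := frequently_iff_neBot.1 (frequently_isUpcrossingStart hcd.le hlow hhigh)
  obtain ⟨U, hUle⟩ := Ultrafilter.exists_le
    (atTop ⊓ 𝓟 {n | IsUpcrossingStart (fun k => f (x k)) c d n})
  obtain ⟨hU, hstart⟩ := le_inf_iff.1 hUle
  rw [le_principal_iff] at hstart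
  obtain ⟨p, hpK, hp⟩ := h.exists_tendsto hK U
  obtain ⟨y, hy, rfl, hlim⟩ := h.exists_isSubgradientFlow hK.isClosed hf hU hp
  have hfy (t : ℝ) : Tendsto (fun n => f (x (windowEnd γ n t))) U (𝓝 (f (y t))) :=
    (hf _ (hy.mem t)).continuousAt.tendsto.comp (hlim t)
  have hfy0 : f (y 0) = c := by
    refine tendsto_nhds_unique ((hf _ hpK).continuousAt.tendsto.comp hp)
      (tendsto_of_eventually_isUpcrossingStart hstart ?_)
    refine squeeze_zero_norm (fun n => ?_) (?_ : Tendsto (fun n => B * γ n) U (𝓝 0))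
    · exact (dist_eq_norm' (f (x n)) _).ge.trans (hB n)
    · simpa using (h.isStepSize.tendsto_zero.mono_left hU).const_mul (B : ℝ)
  obtain ⟨τ, hτ, hBτ⟩ : ∃ τ : ℝ, 0 < τ ∧ B * τ < d - c :=
    exists_pos_mul_lt (sub_pos.2 hcd) B
  have hle : c ≤ f (y τ) := by
    have hdur :=
      ((h.isStepSize.tendsto_stepTime_windowEnd_sub τ).mono_left hU).const_mul (B : ℝ)
    rw [max_eq_left hτ.le] at hdur
    refine ge_of_tendsto (hfy τ) ?_
    filter_upwards [hstart, hdur.eventually_lt_const hBτ] with n hn hshort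
    exact (hn.lt_apply_windowEnd h.isStepSize hB hτ hshort.le).le
  have hlt := hy.comp_lt_of_notMem_stationarySet hK hf hreg (fun hS => hc ⟨_, hS, hfy0⟩) hτ
  linarith

theorem mem_stationarySet_of_tendsto [FiniteDimensional ℝ E]
    (h : IsSubgradientScheme f K C γ x v η ν) (hK : IsCompact K)
    (hf : ∀ z ∈ K, IsLipschitzNear f z) (hreg : ∀ z ∈ K, IsClarkeRegularAt f z)
    (hS : interior (f '' stationarySet f K) = ∅) {U : Ultrafilter ℕ}
    (hU : (U : Filter ℕ) ≤ atTop) {p : E} (hp : Tendsto x U (𝓝 p)) : p ∈ stationarySet f K := by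
  by_contra hpS
  obtain ⟨y, hy, rfl, hlim⟩ := h.exists_isSubgradientFlow hK.isClosed hf hU hp
  obtain ⟨c, hc, hyc, hcy⟩ := (interior_eq_empty_iff_dense_compl.1 hS).exists_between
    (hy.comp_lt_of_notMem_stationarySet hK hf hreg hpS one_pos)
  obtain ⟨d, hcd, hdy⟩ := exists_between hcy
  refine h.not_frequently_upcrossing hK hf hreg hcd hc ?_ ?_
  · have hlow := ((hf _ (hy.mem 1)).continuousAt.tendsto.comp (hlim 1)).eventually_le_const hyc
    exact ((h.isStepSize.tendsto_windowEnd 1).mono_left hU).frequently hlow.frequently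
  · have hhigh := ((hf _ (hy.mem 0)).continuousAt.tendsto.comp hp).eventually_const_lt hdy
    exact hhigh.frequently.filter_mono hU

theorem stationarySet_nonempty_and_tendsto_infDist [FiniteDimensional ℝ E]
    (h : IsSubgradientScheme f K C γ x v η ν) (hK : IsCompact K)
    (hf : ∀ z ∈ K, IsLipschitzNear f z) (hreg : ∀ z ∈ K, IsClarkeRegularAt f z)
    (hS : interior (f '' stationarySet f K) = ∅) :
    (stationarySet f K).Nonempty ∧
      Tendsto (fun k => Metric.infDist (x k) (stationarySet f K)) atTop (𝓝 0) := by
  have hlim (U : Ultrafilter ℕ) (hU : (U : Filter ℕ) ≤ atTop) :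
      ∃ p ∈ stationarySet f K, Tendsto x U (𝓝 p) :=
    let ⟨p, _, hp⟩ := h.exists_tendsto hK U
    ⟨p, h.mem_stationarySet_of_tendsto hK hf hreg hS hU hp, hp⟩
  constructor
  · obtain ⟨p, hp, -⟩ := hlim (Ultrafilter.of atTop) (Ultrafilter.of_le _)
    exact ⟨p, hp⟩
  · refine (tendsto_iff_ultrafilter _ _ _).2 fun U hU => ?_
    obtain ⟨p, hp, hpx⟩ := hlim U hU
    rw [← Metric.infDist_zero_of_mem hp]
    exact ((Metric.continuous_infDist_pt _).tendsto p).comp hpx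

end IsSubgradientScheme

end Scheme

section ProjectedSubgradient

open scoped NNReal

variable {E : Type*} [NormedAddCommGroup E] [InnerProductSpace ℝ E] {f : E → ℝ} {K : Set E}

lemma exists_isSubgradientScheme_of_isProjectionOnto (hKconv : Convex ℝ K) (hK : IsCompact K)
    (hf : ∀ z ∈ K, IsLipschitzNear f z) {γ : ℕ → ℝ} (hγ : IsStepSize γ)
    (hγpos : ∀ k, 0 < γ k) {x v ν : ℕ → E} {D : ℝ} (hx0 : x 0 ∈ K)
    (hv : ∀ k, v k ∈ clarkeGradient f (x k)) (hνD : ∀ k, ‖ν k‖ ≤ D)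
    (hν : IsLimitCurve γ ν atTop 0)
    (hx : ∀ k, IsProjectionOnto K (x k - γ k • (v k + ν k)) (x (k + 1))) :
    ∃ (C : ℝ≥0) (η : ℕ → E), IsSubgradientScheme f K C γ x v η ν := by
  have hxK : ∀ k, x k ∈ K
    | 0 => hx0
    | k + 1 => (hx k).1
  obtain ⟨M, hM⟩ := isBounded_iff_forall_norm_le.1 (isBounded_biUnion_clarkeGradient hK hf)
  have hvM (k : ℕ) : ‖v k‖ ≤ M := hM _ (Set.mem_biUnion (hxK k) (hv k))
  choose η hη hηle hstep using fun k => (hx k).exists_normal hKconv (hxK k) (hγpos k)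
  have hM0 : 0 ≤ M := (norm_nonneg _).trans (hvM 0)
  have hD0 : 0 ≤ D := (norm_nonneg _).trans (hνD 0)
  have hηMD (k : ℕ) : ‖η k‖ ≤ M + D :=
    (hηle k).trans (norm_add_le_of_le (hvM k) (hνD k))
  refine ⟨.mk (M + D + (M + D)) (by positivity), η, hγ, hxK, hv, hη,
    fun k => ?_, fun k => ?_, fun k => ?_, fun k => ?_, hν⟩
  · exact (hvM k).trans (by rw [NNReal.coe_mk]; linarith)
  · exact (hηMD k).trans (by rw [NNReal.coe_mk]; linarith)
  · rw [hstep k, dist_self_sub_right, norm_smul, Real.norm_of_nonneg (hγpos k).le, mul_comm]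
    exact mul_le_mul_of_nonneg_right
      (norm_add_le_of_le (norm_add_le_of_le (hvM k) (hνD k)) (hηMD k)) (hγpos k).le
  · rw [add_right_comm]
    exact hstep k

theorem stationarySet_nonempty_and_tendsto_infDist_of_isProjectionOnto [FiniteDimensional ℝ E]
    (hKconv : Convex ℝ K) (hK : IsCompact K) (hf : ∀ z ∈ K, IsLipschitzNear f z)
    (hreg : ∀ z ∈ K, IsClarkeRegularAt f z) {γ : ℕ → ℝ} (hγ : IsStepSize γ)
    (hγpos : ∀ k, 0 < γ k) {x v e r : ℕ → E} {S : E} {D : ℝ} (hx0 : x 0 ∈ K)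
    (hv : ∀ k, v k ∈ clarkeGradient f (x k)) (hD : ∀ k, ‖e k + r k‖ ≤ D)
    (he : Tendsto (fun n => ∑ k ∈ Finset.range n, γ k • e k) atTop (𝓝 S))
    (hr : Tendsto r atTop (𝓝 0))
    (hx : ∀ k, IsProjectionOnto K (x k - γ k • (v k + (e k + r k))) (x (k + 1)))
    (hS : interior (f '' stationarySet f K) = ∅) :
    (stationarySet f K).Nonempty ∧
      Tendsto (fun k => Metric.infDist (x k) (stationarySet f K)) atTop (𝓝 0) := by
  have hnoise : IsLimitCurve γ (e + r) atTop 0 := add_zero (0 : ℝ → E) ▸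
    (hγ.isLimitCurve_zero_of_tendsto_sum he).add (hγ.isLimitCurve_zero_of_tendsto_zero hr)
  obtain ⟨C, η, h⟩ := exists_isSubgradientScheme_of_isProjectionOnto hKconv hK hf hγ hγpos hx0 hv
    hD hnoise hx
  exact h.stationarySet_nonempty_and_tendsto_infDist hK hf hreg hS

end ProjectedSubgradient

lemma sum_range_add_two {M : Type*} [AddCommGroup M] (a : ℕ → M) (n : ℕ) :
    ∑ k ∈ Finset.range n, a (k + 2) = ∑ k ∈ Finset.Icc 1 (n + 1), a k - a 1 := by
  induction n with
  | zero => simp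
  | succ n ih =>
    rw [Finset.sum_range_succ, ih, Finset.sum_Icc_succ_top (by omega : 1 ≤ n + 1 + 1)]
    abel

theorem mainTheorem9_general {E : Type*} [NormedAddCommGroup E] [InnerProductSpace ℝ E]
    [FiniteDimensional ℝ E] (K : Set E) (f : E → ℝ) (hKconv : Convex ℝ K) (hKcomp : IsCompact K)
    (hLip : ∀ z ∈ K, IsLipschitzNear f z) (hreg : ∀ z ∈ K, IsClarkeRegularAt f z)
    (γ : ℕ → ℝ) (hγpos : ∀ k, 1 ≤ k → 0 < γ k)
    (hγsum : Tendsto (fun n : ℕ => ∑ k ∈ Finset.Icc 1 n, γ k) atTop atTop)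
    (hγlim : Tendsto γ atTop (𝓝 0))
    (δ e r : ℕ → E) (hδ : ∀ k, 1 ≤ k → δ k = e k + r k)
    (hr : Tendsto (fun k => ‖r k‖) atTop (𝓝 0))
    (he : ∃ s, Tendsto (fun n : ℕ => ∑ k ∈ Finset.Icc 1 n, γ k • e k) atTop (𝓝 s))
    (hδbdd : ∃ C : ℝ, ∀ k, 1 ≤ k → ‖δ k‖ ≤ C)
    (x v Y : ℕ → E) (hv : ∀ k, 1 ≤ k → v k ∈ clarkeGradient f (x (k - 1)))
    (hY : ∀ k, 1 ≤ k → Y k = v k + δ k)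
    (hx : ∀ k, 1 ≤ k → IsProjectionOnto K (x (k - 1) - γ k • Y k) (x k))
    (hS : interior (f '' stationarySet f K) = ∅) :
    (stationarySet f K).Nonempty ∧
      Tendsto (fun k => Metric.infDist (x k) (stationarySet f K)) atTop (𝓝 0) := by
  obtain ⟨s, hs⟩ := he
  obtain ⟨D, hD⟩ := hδbdd
  have hγ : IsStepSize fun k => γ (k + 2) := by
    refine ⟨fun k => (hγpos _ (by omega)).le, ?_, hγlim.comp (tendsto_add_atTop_nat 2)⟩
    refine (tendsto_atTop_add_const_right _ (-γ 1)
      (hγsum.comp (tendsto_add_atTop_nat 1))).congr fun n => ?_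
    rw [← sub_eq_add_neg]
    exact (sum_range_add_two γ n).symm
  have hnoise : Tendsto (fun n => ∑ k ∈ Finset.range n, γ (k + 2) • e (k + 2)) atTop
      (𝓝 (s - γ 1 • e 1)) := by
    refine ((hs.comp (tendsto_add_atTop_nat 1)).sub_const _).congr fun n => ?_
    exact (sum_range_add_two (fun k => γ k • e k) n).symm
  have hrem : Tendsto (fun k => r (k + 2)) atTop (𝓝 0) :=
    (tendsto_zero_iff_norm_tendsto_zero.2 hr).comp (tendsto_add_atTop_nat 2)
  have hproj (k : ℕ) : IsProjectionOnto K
      (x (k + 1) - γ (k + 2) • (v (k + 2) + (e (k + 2) + r (k + 2)))) (x (k + 2)) := by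
    rw [← hδ _ (by omega), ← hY _ (by omega)]
    exact hx (k + 2) (by omega)
  have hbound (k : ℕ) : ‖e (k + 2) + r (k + 2)‖ ≤ D := hδ (k + 2) (by omega) ▸ hD _ (by omega)
  obtain ⟨hne, hlim⟩ := stationarySet_nonempty_and_tendsto_infDist_of_isProjectionOnto hKconv hKcomp
    hLip hreg hγ (fun k => hγpos _ (by omega)) (x := fun k => x (k + 1)) (hx 1 le_rfl).1
    (fun k => hv (k + 2) (by omega)) hbound hnoise hrem hproj hS
  exact ⟨hne, (tendsto_add_atTop_iff_nat 1).1 hlim⟩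

theorem mainTheorem9 (d : ℕ)
    (X K : Set (EuclideanSpace ℝ (Fin d))) (f : EuclideanSpace ℝ (Fin d) → ℝ)
    (hX : IsOpen X) (hKX : K ⊆ X) (hKconv : Convex ℝ K) (hKcomp : IsCompact K)
    (hLip : LocallyLipschitzOn X f) (hreg : ∀ z ∈ X, IsClarkeRegularAt f z)
    -- step sizes (only the indices k ≥ 1 are used)
    (γ : ℕ → ℝ) (hγpos : ∀ k, 1 ≤ k → 0 < γ k)
    (hγsum : Tendsto (fun n : ℕ => ∑ k ∈ Finset.Icc 1 n, γ k) atTop atTop)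
    (hγlim : Tendsto γ atTop (𝓝 0))
    -- noise
    (δ e r : ℕ → EuclideanSpace ℝ (Fin d))
    (hδ : ∀ k, 1 ≤ k → δ k = e k + r k)
    (hr : Tendsto (fun k => ‖r k‖) atTop (𝓝 0))
    (he : ∃ s, Tendsto (fun n : ℕ => ∑ k ∈ Finset.Icc 1 n, γ k • e k) atTop (𝓝 s))
    (hδbdd : ∃ C : ℝ, ∀ k, 1 ≤ k → ‖δ k‖ ≤ C)
    -- iterates
    (x v Y : ℕ → EuclideanSpace ℝ (Fin d)) (hx0 : x 0 ∈ X)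
    (hv : ∀ k, 1 ≤ k → v k ∈ clarkeGradient f (x (k - 1)))
    (hY : ∀ k, 1 ≤ k → Y k = v k + δ k)
    (hx : ∀ k, 1 ≤ k → IsProjectionOnto K (x (k - 1) - γ k • Y k) (x k))
    (hS : interior (f '' stationarySet f K) = ∅) :
    (stationarySet f K).Nonempty ∧
      Tendsto (fun k => Metric.infDist (x k) (stationarySet f K)) atTop (𝓝 0) :=
  mainTheorem9_general K f hKconv hKcomp
    (fun _ hz => isLipschitzNear_of_locallyLipschitzOn hLip (hX.mem_nhds (hKX hz)))
    (fun z hz => hreg z (hKX hz)) γ hγpos hγsum hγlim δ e r hδ hr he hδbdd x v Y hv hY hx hS
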